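/- A \emph{birestriction monoid} is an algebra $(S;\cdot,{}^*,{}^+,1)$ of type $(2,1,1,0)$ such that $(S;\cdot,1)$ is a monoid and the identities $xx^*=x$, $x^*y^*=y^*x^*$, $(xy^*)^*=x^*y^*$, $x^*y=y(xy)^*$, $x^+x=x$, $x^+y^+=y^+x^+$, $(x^+y)^+=x^+y^+$, $xy^+=(xy)^+x$, $(x^+)^*=x^+$ and $(x^*)^+=x^*$ hold. Every inverse monoid is regarded as a birestriction monoid via $x^*=x^{-1}x$, $x^+=xx^{-1}$. For a set $Y$ and a set $R$ of relations between elements of the free birestriction monoid $\mathsf{FBR}(Y)$, $\mathrm{BRestr}\langle Y\mid R\rangle$ is the quotient of $\mathsf{FBR}(Y)$ by the $(2,1,1,0)$-congruence generated by $R$. Its universal inverse monoid is $\mathrm{Inv}\langle Y\mid \psi(R)\rangle$, where $\psi\colon\mathsf{FBR}(Y)\to\mathsf{FI}(Y)$ is the $(2,1,1,0)$-morphism to the free inverse monoid that is the identity on $Y$. A $Y$-generated birestriction monoid $S$ \emph{admits a geometric model} if there are a $Y$-generated inverse monoid $U$ that is $E$-unitary (i.e. if $e$ and $es$ are idempotents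 of $U$, then so is $s$) and an injective $(2,1,1,0)$-morphism $S\to U$ that commutes with the assignment maps from $Y$. Let $X$ be a set, $X^+$ the free semigroup on $X$, $\overline{X^+}=\{\overline{u}\colon u\in X^+\}$ a bijective copy of $X^+$ disjoint from $X$, and $Y=X\cup\overline{X^+}$. Define the following sets of relations on $\mathsf{FBR}(Y)$: $$N_{ls}=\{x=\overline{x}\,x^*,\ \overline{u}\,\overline{v}=\overline{u}^+\,\overline{uv}\colon x\in X,\ u,v\in X^+\},$$ $$N_{rs}=\{x=\overline{x}\,x^*,\ \overline{u}\,\overline{v}=\overline{uv}\,\overline{v}^*\colon x\in X,\ u,v\in X^+\},$$ and $N_s=N_{ls}\cup N_{rs}$. For $i\in\{ls,rs,s\}$ put $\mathcal F_i=\mathrm{BRestr}\langle Y\mid N_i\rangle$, which is $Y$-generated via the natural map, and let $\mathcal I_i=\mathrm{Inv}\langle Y\mid\psi(N_i)\rangle$ be its universal inverse monoid. \textbf{Theorem.} Let $X=\{x\}$ be a one-element set and $i\in\{ls,rs,s\}$. Then the birestriction monoid $\mathcal F_i$ admits a geometric model. Moreover, the inverse monoid $\mathcal I_i$ is $E$-unitary.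 -/

import Mathlib

universe u

/-! ### Birestriction monoids -/

/-- A birestriction monoid: an algebra `(S; *, rstar, rplus, 1)` of type `(2,1,1,0)`,
where `rstar x` is the usual `x^*` and `rplus x` is the usual `x^+`. -/
class BirestrictionMonoid (S : Type u) extends Monoid S where
  rstar : S → S
  rplus : S → S
  mul_rstar_self : ∀ x : S, x * rstar x = x
  rstar_mul_comm : ∀ x y : S, rstar x * rstar y = rstar y * rstar x
  rstar_mul_rstar : ∀ x y : S, rstar (x * rstar y) = rstar x * rstar y
  rstar_ample : ∀ x y : S, rstar x * y = y * rstar (x * y)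
  rplus_mul_self : ∀ x : S, rplus x * x = x
  rplus_mul_comm : ∀ x y : S, rplus x * rplus y = rplus y * rplus x
  rplus_rplus_mul : ∀ x y : S, rplus (rplus x * y) = rplus x * rplus y
  rplus_ample : ∀ x y : S, x * rplus y = rplus (x * y) * x
  rstar_rplus : ∀ x : S, rstar (rplus x) = rplus x
  rplus_rstar : ∀ x : S, rplus (rstar x) = rstar x

open BirestrictionMonoid (rstar rplus)

/-- Morphisms of birestriction monoids, that is, `(2,1,1,0)`-morphisms. -/
structure IsBirestrictionHom {S T : Type u} [BirestrictionMonoid S] [BirestrictionMonoid T]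
    (f : S → T) : Prop where
  map_one : f 1 = 1
  map_mul : ∀ a b : S, f (a * b) = f a * f b
  map_rstar : ∀ a : S, f (rstar a) = rstar (f a)
  map_rplus : ∀ a : S, f (rplus a) = rplus (f a)

/-- `S` is `Y`-generated via the assignment map `ι`: the only `(2,1,1,0)`-subalgebra of `S`
containing all `ι y` is `S` itself. -/
def BirestrictionMonoid.IsGeneratedVia {Y S : Type u} [BirestrictionMonoid S] (ι : Y → S) : Prop :=
  ∀ T : Set S, (∀ y, ι y ∈ T) → 1 ∈ T → (∀ a ∈ T, ∀ b ∈ T, a * b ∈ T) →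
    (∀ a ∈ T, rstar a ∈ T) → (∀ a ∈ T, rplus a ∈ T) → ∀ a : S, a ∈ T

/-! ### Inverse monoids -/

/-- Inverse monoids, as the standard variety of type `(2,1,0)`. -/
class InverseMonoid (U : Type u) extends Monoid U, Inv U where
  inv_inv' : ∀ x : U, x⁻¹⁻¹ = x
  mul_inv_rev' : ∀ x y : U, (x * y)⁻¹ = y⁻¹ * x⁻¹
  mul_inv_mul_self : ∀ x : U, x * x⁻¹ * x = x
  mul_inv_comm : ∀ x y : U, x * x⁻¹ * (y * y⁻¹) = y * y⁻¹ * (x * x⁻¹)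

namespace InverseMonoid

theorem inv_mul_comm {U : Type u} [InverseMonoid U] (x y : U) :
    x⁻¹ * x * (y⁻¹ * y) = y⁻¹ * y * (x⁻¹ * x) := by
  have h := mul_inv_comm x⁻¹ y⁻¹
  rwa [inv_inv', inv_inv'] at h

theorem mul_inv_mul_inv_comm {U : Type u} [InverseMonoid U] (x y : U) :
    x⁻¹ * x * (y * y⁻¹) = y * y⁻¹ * (x⁻¹ * x) := by
  have h := mul_inv_comm x⁻¹ y
  rwa [inv_inv'] at h

theorem inv_mul_inv_self {U : Type u} [InverseMonoid U] (x : U) : x⁻¹ * x * x⁻¹ = x⁻¹ := by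
  have h := mul_inv_mul_self x⁻¹
  rwa [inv_inv'] at h

/-- Every inverse monoid is a birestriction monoid with `x^* = x⁻¹ x` and `x^+ = x x⁻¹`. -/
instance toBirestrictionMonoid {U : Type u} [InverseMonoid U] : BirestrictionMonoid U where
  rstar x := x⁻¹ * x
  rplus x := x * x⁻¹
  mul_rstar_self x := by rw [← mul_assoc, mul_inv_mul_self]
  rstar_mul_comm x y := inv_mul_comm x y
  rstar_mul_rstar x y := by
    have e : (x * (y⁻¹ * y))⁻¹ * (x * (y⁻¹ * y))
        = y⁻¹ * y * (x⁻¹ * x) * (y⁻¹ * y) := by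
      simp only [mul_inv_rev', inv_inv', mul_assoc]
    have h : y⁻¹ * y * (y⁻¹ * y) = y⁻¹ * y := by
      rw [← mul_assoc, inv_mul_inv_self]
    rw [e, inv_mul_comm y x, mul_assoc, h]
  rstar_ample x y := by
    have e : y * ((x * y)⁻¹ * (x * y)) = y * y⁻¹ * (x⁻¹ * x) * y := by
      simp only [mul_inv_rev', mul_assoc]
    rw [e, ← mul_inv_mul_inv_comm, mul_assoc (x⁻¹ * x) (y * y⁻¹) y, mul_inv_mul_self]
  rplus_mul_self x := mul_inv_mul_self x
  rplus_mul_comm x y := mul_inv_comm x y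
  rplus_rplus_mul x y := by
    have e : (x * x⁻¹ * y) * (x * x⁻¹ * y)⁻¹
        = x * x⁻¹ * (y * y⁻¹) * (x * x⁻¹) := by
      simp only [mul_inv_rev', inv_inv', mul_assoc]
    have h : x * x⁻¹ * (x * x⁻¹) = x * x⁻¹ := by
      rw [← mul_assoc, mul_inv_mul_self]
    rw [e, mul_assoc, mul_inv_comm y x, ← mul_assoc, h]
  rplus_ample x y := by
    have e : (x * y) * (x * y)⁻¹ * x = x * (y * y⁻¹ * (x⁻¹ * x)) := by
      simp only [mul_inv_rev', mul_assoc]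
    rw [e, ← mul_inv_mul_inv_comm, ← mul_assoc x (x⁻¹ * x), ← mul_assoc x x⁻¹ x,
      mul_inv_mul_self]
  rstar_rplus x := by
    rw [mul_inv_rev', inv_inv', ← mul_assoc, mul_inv_mul_self]
  rplus_rstar x := by
    rw [mul_inv_rev', inv_inv', ← mul_assoc, inv_mul_inv_self]

/-- `U` is `Y`-generated, as an inverse monoid, via the assignment map `ι`. -/
def IsGeneratedVia {Y U : Type u} [InverseMonoid U] (ι : Y → U) : Prop :=
  ∀ T : Set U, (∀ y, ι y ∈ T) → 1 ∈ T → (∀ a ∈ T, ∀ b ∈ T, a * b ∈ T) →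
    (∀ a ∈ T, a⁻¹ ∈ T) → ∀ a : U, a ∈ T

/-- `U` is `E`-unitary: an element above an idempotent in the natural partial order is an
idempotent. (Here `e * s` is the generic element below `s` when `e` ranges over idempotents.) -/
def IsEUnitary (U : Type u) [InverseMonoid U] : Prop :=
  ∀ e s : U, IsIdempotentElem e → IsIdempotentElem (e * s) → IsIdempotentElem s

end InverseMonoid

/-- A `Y`-generated birestriction monoid `S` (via `ι`) admits a geometric model: it canonically
`(2,1,1,0)`-embeds into a `Y`-generated `E`-unitary inverse monoid. -/
def AdmitsGeometricModel {Y S : Type u} [BirestrictionMonoid S] (ι : Y → S) : Prop :=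
  BirestrictionMonoid.IsGeneratedVia ι ∧
    ∃ (U : Type u) (_ : InverseMonoid U) (κ : Y → U) (f : S → U),
      InverseMonoid.IsGeneratedVia κ ∧ InverseMonoid.IsEUnitary U ∧
      IsBirestrictionHom f ∧ Function.Injective f ∧ ∀ y, f (ι y) = κ y

/-! ### Free birestriction monoids and presentations -/

/-- Terms of the signature `(2,1,1,0)` over `Y`. -/
inductive BRTerm (Y : Type u) : Type u
  | of : Y → BRTerm Y
  | one : BRTerm Y
  | mul : BRTerm Y → BRTerm Y → BRTerm Y
  | star : BRTerm Y → BRTerm Y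
  | plus : BRTerm Y → BRTerm Y

/-- The least congruence on terms which contains all instances of the identities of
birestriction monoids. -/
inductive BRTerm.Rel {Y : Type u} : BRTerm Y → BRTerm Y → Prop
  | refl (a) : Rel a a
  | symm {a b} : Rel a b → Rel b a
  | trans {a b c} : Rel a b → Rel b c → Rel a c
  | mul {a b c d} : Rel a b → Rel c d → Rel (.mul a c) (.mul b d)
  | star {a b} : Rel a b → Rel (.star a) (.star b)
  | plus {a b} : Rel a b → Rel (.plus a) (.plus b)
  | mul_assoc (a b c) : Rel (.mul (.mul a b) c) (.mul a (.mul b c))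
  | one_mul (a) : Rel (.mul .one a) a
  | mul_one (a) : Rel (.mul a .one) a
  | mul_star_self (a) : Rel (.mul a (.star a)) a
  | star_mul_comm (a b) : Rel (.mul (.star a) (.star b)) (.mul (.star b) (.star a))
  | star_mul_star (a b) : Rel (.star (.mul a (.star b))) (.mul (.star a) (.star b))
  | star_ample (a b) : Rel (.mul (.star a) b) (.mul b (.star (.mul a b)))
  | plus_mul_self (a) : Rel (.mul (.plus a) a) a
  | plus_mul_comm (a b) : Rel (.mul (.plus a) (.plus b)) (.mul (.plus b) (.plus a))
  | plus_plus_mul (a b) : Rel (.plus (.mul (.plus a) b)) (.mul (.plus a) (.plus b))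
  | plus_ample (a b) : Rel (.mul a (.plus b)) (.mul (.plus (.mul a b)) a)
  | star_plus (a) : Rel (.star (.plus a)) (.plus a)
  | plus_star (a) : Rel (.plus (.star a)) (.star a)

/-- `Rel` as a setoid. -/
def BRTerm.relSetoid (Y : Type u) : Setoid (BRTerm Y) :=
  ⟨BRTerm.Rel, BRTerm.Rel.refl, BRTerm.Rel.symm, BRTerm.Rel.trans⟩

/-- The free birestriction monoid on `Y`. -/
def FBR (Y : Type u) : Type u := Quotient (BRTerm.relSetoid Y)

namespace FBR

instance (Y : Type u) : BirestrictionMonoid (FBR Y) where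
  one := Quotient.mk _ .one
  mul := Quotient.map₂ .mul fun _ _ h _ _ k => .mul h k
  rstar := Quotient.map .star fun _ _ h => .star h
  rplus := Quotient.map .plus fun _ _ h => .plus h
  mul_assoc := by rintro ⟨a⟩ ⟨b⟩ ⟨c⟩; exact Quotient.sound (.mul_assoc a b c)
  one_mul := by rintro ⟨a⟩; exact Quotient.sound (.one_mul a)
  mul_one := by rintro ⟨a⟩; exact Quotient.sound (.mul_one a)
  mul_rstar_self := by rintro ⟨a⟩; exact Quotient.sound (.mul_star_self a)
  rstar_mul_comm := by rintro ⟨a⟩ ⟨b⟩; exact Quotient.sound (.star_mul_comm a b)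
  rstar_mul_rstar := by rintro ⟨a⟩ ⟨b⟩; exact Quotient.sound (.star_mul_star a b)
  rstar_ample := by rintro ⟨a⟩ ⟨b⟩; exact Quotient.sound (.star_ample a b)
  rplus_mul_self := by rintro ⟨a⟩; exact Quotient.sound (.plus_mul_self a)
  rplus_mul_comm := by rintro ⟨a⟩ ⟨b⟩; exact Quotient.sound (.plus_mul_comm a b)
  rplus_rplus_mul := by rintro ⟨a⟩ ⟨b⟩; exact Quotient.sound (.plus_plus_mul a b)
  rplus_ample := by rintro ⟨a⟩ ⟨b⟩; exact Quotient.sound (.plus_ample a b)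
  rstar_rplus := by rintro ⟨a⟩; exact Quotient.sound (.star_plus a)
  rplus_rstar := by rintro ⟨a⟩; exact Quotient.sound (.plus_star a)

/-- The free generators. -/
def of {Y : Type u} (y : Y) : FBR Y := Quotient.mk _ (.of y)

end FBR

/-- The value of a term in a birestriction monoid under an assignment of its variables. -/
def BRTerm.eval {Y S : Type u} [BirestrictionMonoid S] (ι : Y → S) : BRTerm Y → S
  | .of y => ι y
  | .one => 1
  | .mul a b => a.eval ι * b.eval ι
  | .star a => rstar (a.eval ι)
  | .plus a => rplus (a.eval ι)

theorem BRTerm.Rel.eval_eq {Y S : Type u} [BirestrictionMonoid S] (ι : Y → S) {a b : BRTerm Y}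
    (h : BRTerm.Rel a b) : a.eval ι = b.eval ι := by
  induction h with
  | refl => rfl
  | symm _ ih => exact ih.symm
  | trans _ _ ih₁ ih₂ => exact ih₁.trans ih₂
  | mul _ _ ih₁ ih₂ => simp only [BRTerm.eval, ih₁, ih₂]
  | star _ ih => simp only [BRTerm.eval, ih]
  | plus _ ih => simp only [BRTerm.eval, ih]
  | mul_assoc => exact _root_.mul_assoc _ _ _
  | one_mul => exact _root_.one_mul _
  | mul_one => exact _root_.mul_one _
  | mul_star_self => exact BirestrictionMonoid.mul_rstar_self _
  | star_mul_comm => exact BirestrictionMonoid.rstar_mul_comm _ _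
  | star_mul_star => exact BirestrictionMonoid.rstar_mul_rstar _ _
  | star_ample => exact BirestrictionMonoid.rstar_ample _ _
  | plus_mul_self => exact BirestrictionMonoid.rplus_mul_self _
  | plus_mul_comm => exact BirestrictionMonoid.rplus_mul_comm _ _
  | plus_plus_mul => exact BirestrictionMonoid.rplus_rplus_mul _ _
  | plus_ample => exact BirestrictionMonoid.rplus_ample _ _
  | star_plus => exact BirestrictionMonoid.rstar_rplus _
  | plus_star => exact BirestrictionMonoid.rplus_rstar _

/-- The canonical morphism from the free birestriction monoid extending an assignment map. -/
def FBR.lift {Y S : Type u} [BirestrictionMonoid S] (ι : Y → S) : FBR Y → S :=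
  Quotient.lift (BRTerm.eval ι) fun _ _ h => BRTerm.Rel.eval_eq ι h

/-- The `(2,1,1,0)`-congruence on a birestriction monoid generated by a relation `R`. -/
inductive BRConGen {S : Type u} [BirestrictionMonoid S] (R : S → S → Prop) : S → S → Prop
  | of {a b} : R a b → BRConGen R a b
  | refl (a) : BRConGen R a a
  | symm {a b} : BRConGen R a b → BRConGen R b a
  | trans {a b c} : BRConGen R a b → BRConGen R b c → BRConGen R a c
  | mul {a b c d} : BRConGen R a b → BRConGen R c d → BRConGen R (a * c) (b * d)
  | rstar {a b} : BRConGen R a b → BRConGen R (rstar a) (rstar b)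
  | rplus {a b} : BRConGen R a b → BRConGen R (rplus a) (rplus b)

/-- `BRConGen R` as a setoid. -/
def BRConGen.setoid {S : Type u} [BirestrictionMonoid S] (R : S → S → Prop) : Setoid S :=
  ⟨BRConGen R, BRConGen.refl, BRConGen.symm, BRConGen.trans⟩

/-- The birestriction monoid `BRestr⟨Y | R⟩`, for a relation `R` on the free birestriction
monoid on `Y`. -/
def BRestr {Y : Type u} (R : FBR Y → FBR Y → Prop) : Type u := Quotient (BRConGen.setoid R)

namespace BRestr

instance {Y : Type u} (R : FBR Y → FBR Y → Prop) : BirestrictionMonoid (BRestr R) where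
  one := Quotient.mk _ 1
  mul := Quotient.map₂ (· * ·) fun _ _ h _ _ k => .mul h k
  rstar := Quotient.map rstar fun _ _ h => .rstar h
  rplus := Quotient.map rplus fun _ _ h => .rplus h
  mul_assoc := by rintro ⟨a⟩ ⟨b⟩ ⟨c⟩; exact congrArg (Quotient.mk _) (mul_assoc a b c)
  one_mul := by rintro ⟨a⟩; exact congrArg (Quotient.mk _) (one_mul a)
  mul_one := by rintro ⟨a⟩; exact congrArg (Quotient.mk _) (mul_one a)
  mul_rstar_self := by
    rintro ⟨a⟩; exact congrArg (Quotient.mk _) (BirestrictionMonoid.mul_rstar_self a)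
  rstar_mul_comm := by
    rintro ⟨a⟩ ⟨b⟩; exact congrArg (Quotient.mk _) (BirestrictionMonoid.rstar_mul_comm a b)
  rstar_mul_rstar := by
    rintro ⟨a⟩ ⟨b⟩; exact congrArg (Quotient.mk _) (BirestrictionMonoid.rstar_mul_rstar a b)
  rstar_ample := by
    rintro ⟨a⟩ ⟨b⟩; exact congrArg (Quotient.mk _) (BirestrictionMonoid.rstar_ample a b)
  rplus_mul_self := by
    rintro ⟨a⟩; exact congrArg (Quotient.mk _) (BirestrictionMonoid.rplus_mul_self a)
  rplus_mul_comm := by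
    rintro ⟨a⟩ ⟨b⟩; exact congrArg (Quotient.mk _) (BirestrictionMonoid.rplus_mul_comm a b)
  rplus_rplus_mul := by
    rintro ⟨a⟩ ⟨b⟩; exact congrArg (Quotient.mk _) (BirestrictionMonoid.rplus_rplus_mul a b)
  rplus_ample := by
    rintro ⟨a⟩ ⟨b⟩; exact congrArg (Quotient.mk _) (BirestrictionMonoid.rplus_ample a b)
  rstar_rplus := by
    rintro ⟨a⟩; exact congrArg (Quotient.mk _) (BirestrictionMonoid.rstar_rplus a)
  rplus_rstar := by
    rintro ⟨a⟩; exact congrArg (Quotient.mk _) (BirestrictionMonoid.rplus_rstar a)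

/-- The canonical assignment map `Y → BRestr⟨Y | R⟩`. -/
def of {Y : Type u} (R : FBR Y → FBR Y → Prop) (y : Y) : BRestr R := Quotient.mk _ (FBR.of y)

end BRestr

/-! ### Free inverse monoids and presentations -/

/-- Terms of the signature `(2,1,0)` over `Y`. -/
inductive InvTerm (Y : Type u) : Type u
  | of : Y → InvTerm Y
  | one : InvTerm Y
  | mul : InvTerm Y → InvTerm Y → InvTerm Y
  | inv : InvTerm Y → InvTerm Y

/-- The least congruence on terms which contains all instances of the identities of
inverse monoids. -/
inductive InvTerm.Rel {Y : Type u} : InvTerm Y → InvTerm Y → Prop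
  | refl (a) : Rel a a
  | symm {a b} : Rel a b → Rel b a
  | trans {a b c} : Rel a b → Rel b c → Rel a c
  | mul {a b c d} : Rel a b → Rel c d → Rel (.mul a c) (.mul b d)
  | inv {a b} : Rel a b → Rel (.inv a) (.inv b)
  | mul_assoc (a b c) : Rel (.mul (.mul a b) c) (.mul a (.mul b c))
  | one_mul (a) : Rel (.mul .one a) a
  | mul_one (a) : Rel (.mul a .one) a
  | inv_inv (a) : Rel (.inv (.inv a)) a
  | mul_inv_rev (a b) : Rel (.inv (.mul a b)) (.mul (.inv b) (.inv a))
  | mul_inv_mul_self (a) : Rel (.mul (.mul a (.inv a)) a) a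
  | mul_inv_comm (a b) :
      Rel (.mul (.mul a (.inv a)) (.mul b (.inv b))) (.mul (.mul b (.inv b)) (.mul a (.inv a)))

/-- `Rel` as a setoid. -/
def InvTerm.relSetoid (Y : Type u) : Setoid (InvTerm Y) :=
  ⟨InvTerm.Rel, InvTerm.Rel.refl, InvTerm.Rel.symm, InvTerm.Rel.trans⟩

/-- The free inverse monoid on `Y`. -/
def FI (Y : Type u) : Type u := Quotient (InvTerm.relSetoid Y)

namespace FI

instance (Y : Type u) : InverseMonoid (FI Y) where
  one := Quotient.mk _ .one
  mul := Quotient.map₂ .mul fun _ _ h _ _ k => .mul h k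
  inv := Quotient.map .inv fun _ _ h => .inv h
  mul_assoc := by rintro ⟨a⟩ ⟨b⟩ ⟨c⟩; exact Quotient.sound (.mul_assoc a b c)
  one_mul := by rintro ⟨a⟩; exact Quotient.sound (.one_mul a)
  mul_one := by rintro ⟨a⟩; exact Quotient.sound (.mul_one a)
  inv_inv' := by rintro ⟨a⟩; exact Quotient.sound (.inv_inv a)
  mul_inv_rev' := by rintro ⟨a⟩ ⟨b⟩; exact Quotient.sound (.mul_inv_rev a b)
  mul_inv_mul_self := by rintro ⟨a⟩; exact Quotient.sound (.mul_inv_mul_self a)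
  mul_inv_comm := by rintro ⟨a⟩ ⟨b⟩; exact Quotient.sound (.mul_inv_comm a b)

/-- The free generators. -/
def of {Y : Type u} (y : Y) : FI Y := Quotient.mk _ (.of y)

end FI

/-- The congruence of inverse monoids generated by a relation `R`. -/
inductive InvConGen {U : Type u} [InverseMonoid U] (R : U → U → Prop) : U → U → Prop
  | of {a b} : R a b → InvConGen R a b
  | refl (a) : InvConGen R a a
  | symm {a b} : InvConGen R a b → InvConGen R b a
  | trans {a b c} : InvConGen R a b → InvConGen R b c → InvConGen R a c
  | mul {a b c d} : InvConGen R a b → InvConGen R c d → InvConGen R (a * c) (b * d)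
  | inv {a b} : InvConGen R a b → InvConGen R a⁻¹ b⁻¹

/-- `InvConGen R` as a setoid. -/
def InvConGen.setoid {U : Type u} [InverseMonoid U] (R : U → U → Prop) : Setoid U :=
  ⟨InvConGen R, InvConGen.refl, InvConGen.symm, InvConGen.trans⟩

/-- The inverse monoid `Inv⟨Y | R⟩`, for a relation `R` on the free inverse monoid on `Y`. -/
def InvPres {Y : Type u} (R : FI Y → FI Y → Prop) : Type u := Quotient (InvConGen.setoid R)

instance {Y : Type u} (R : FI Y → FI Y → Prop) : InverseMonoid (InvPres R) where
  one := Quotient.mk _ 1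
  mul := Quotient.map₂ (· * ·) fun _ _ h _ _ k => .mul h k
  inv := Quotient.map (·⁻¹) fun _ _ h => .inv h
  mul_assoc := by rintro ⟨a⟩ ⟨b⟩ ⟨c⟩; exact congrArg (Quotient.mk _) (mul_assoc a b c)
  one_mul := by rintro ⟨a⟩; exact congrArg (Quotient.mk _) (one_mul a)
  mul_one := by rintro ⟨a⟩; exact congrArg (Quotient.mk _) (mul_one a)
  inv_inv' := by rintro ⟨a⟩; exact congrArg (Quotient.mk _) (InverseMonoid.inv_inv' a)
  mul_inv_rev' := by
    rintro ⟨a⟩ ⟨b⟩; exact congrArg (Quotient.mk _) (InverseMonoid.mul_inv_rev' a b)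
  mul_inv_mul_self := by
    rintro ⟨a⟩; exact congrArg (Quotient.mk _) (InverseMonoid.mul_inv_mul_self a)
  mul_inv_comm := by
    rintro ⟨a⟩ ⟨b⟩; exact congrArg (Quotient.mk _) (InverseMonoid.mul_inv_comm a b)

/-- The canonical `(2,1,1,0)`-morphism `ψ : FBR(Y) → FI(Y)`, identical on `Y`. -/
def FBR.psi (Y : Type u) : FBR Y → FI Y := FBR.lift FI.of

/-- The universal inverse monoid `Inv⟨Y | ψ(R)⟩` of `BRestr⟨Y | R⟩`. -/
abbrev UniversalInverse {Y : Type u} (R : FBR Y → FBR Y → Prop) : Type u :=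
  InvPres fun p q : FI Y => ∃ a b, R a b ∧ FBR.psi Y a = p ∧ FBR.psi Y b = q

/-! ### The monoids `F_i` and `I_i` -/

/-- The extended set of generators: the disjoint union of `X` and a copy of the free semigroup
`X⁺` on `X`. -/
abbrev ExtGen (X : Type u) : Type u := X ⊕ FreeSemigroup X

/-- The generator `x ∈ X`, as an element of the free birestriction monoid. -/
def genX {X : Type u} (x : X) : FBR (ExtGen X) := FBR.of (Sum.inl x)

/-- The generator `ū`, for `u ∈ X⁺`, as an element of the free birestriction monoid. -/
def genBar {X : Type u} (w : FreeSemigroup X) : FBR (ExtGen X) := FBR.of (Sum.inr w)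

/-- The relations `x̄ ≥ x`, that is, `x = x̄ x^*`, and `ū v̄ = ū⁺ (uv)‾`. -/
inductive NLeft (X : Type u) : FBR (ExtGen X) → FBR (ExtGen X) → Prop
  | le (x : X) : NLeft X (genX x) (genBar (FreeSemigroup.of x) * rstar (genX x))
  | strong (v w : FreeSemigroup X) :
      NLeft X (genBar v * genBar w) (rplus (genBar v) * genBar (v * w))

/-- The relations `x̄ ≥ x`, that is, `x = x̄ x^*`, and `ū v̄ = (uv)‾ v̄^*`. -/
inductive NRight (X : Type u) : FBR (ExtGen X) → FBR (ExtGen X) → Prop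
  | le (x : X) : NRight X (genX x) (genBar (FreeSemigroup.of x) * rstar (genX x))
  | strong (v w : FreeSemigroup X) :
      NRight X (genBar v * genBar w) (genBar (v * w) * rstar (genBar w))

/-- The indices `ls` (left strong), `rs` (right strong), `s` (strong). -/
inductive StrengthIndex : Type
  | ls
  | rs
  | s

/-- The sets of relations `N_ls`, `N_rs`, and `N_s = N_ls ∪ N_rs`. -/
def NRel (X : Type u) : StrengthIndex → FBR (ExtGen X) → FBR (ExtGen X) → Prop
  | .ls => NLeft X
  | .rs => NRight X
  | .s => fun a b => NLeft X a b ∨ NRight X a b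

/-- `F_i = BRestr⟨X ∪ X̄⁺ | N_i⟩`. -/
abbrev FMon (X : Type u) (i : StrengthIndex) : Type u := BRestr (NRel X i)

/-- The assignment map `X ∪ X̄⁺ → F_i`. -/
def FMon.of (X : Type u) (i : StrengthIndex) : ExtGen X → FMon X i := BRestr.of (NRel X i)

/-- `I_i = Inv⟨X ∪ X̄⁺ | ψ(N_i)⟩`, the universal inverse monoid of `F_i`. -/
abbrev IMon (X : Type u) (i : StrengthIndex) : Type u := UniversalInverse (NRel X i)

/-! Let `c n` be the generator indexed by the word of length `n` in the single letter, with `c 0 =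
1` (`barPow`). The argument runs on the natural partial order: `a ≤ b` when `a = a⁺ b`, which is
compatible with products and, in inverse monoids, with inversion.

The relations give `c m * c n ≤ c (m + n)`, so every element `s` of `F_i` lies below some `c n`,
that is, `s = s⁺ * c n`. Word length extends to a morphism from `I_i` to the infinite cyclic group,
which recovers `n`. Hence `s` is determined by its degree and by `s⁺`. The degree is visible in
`I_i`. So is `s⁺`: the Munn representation of `F_i` by partial bijections of its projections is
faithful on projections, and it factors through `I_i` because its target is an inverse monoid.
Therefore `F_i → I_i` is injective (`fromBRestr_injective`).

It remains to see that `I_i` is `E`-unitary, since `I_i` itself then serves as the model. Two powers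
of one letter are always comparable as prefixes, and left strength gives `(c m)⁻¹ * c (m + n) ≤ c
n`; so every element lies below some `c m * (c n)⁻¹` (`exists_below_mul_inv`). An element of degree
zero has `m = n`, hence lies below an idempotent and is idempotent (`isEUnitary_of_below`). The
right strong case is the same with `(c n)⁻¹` in place of `c n`. -/

namespace BirestrictionMonoid

variable {S : Type u} [BirestrictionMonoid S]

/-! ### The natural partial order -/

theorem rplus_one : rplus (1 : S) = 1 := by
  have h := rplus_mul_self (1 : S)
  rwa [mul_one] at h

theorem rplus_rplus (a : S) : rplus (rplus a) = rplus a := by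
  have h := rplus_rplus_mul a 1
  rwa [mul_one, rplus_one, mul_one] at h

theorem rplus_mul_rplus_self (a : S) : rplus a * rplus a = rplus a := by
  have h := rplus_mul_self (rplus a)
  rwa [rplus_rplus] at h

/-- The natural partial order: `a ≤ b` if `a = a^+ b`. -/
def Below (a b : S) : Prop := a = rplus a * b

theorem below_rplus_mul (a b : S) : Below (rplus a * b) b := by
  rw [Below, rplus_rplus_mul, mul_assoc, rplus_mul_self]

theorem below_mul_rplus (a b : S) : Below (a * rplus b) a := by
  rw [rplus_ample]
  exact below_rplus_mul _ _

theorem below_mul_rstar (a b : S) : Below (a * rstar b) a := by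
  rw [← rplus_rstar]
  exact below_mul_rplus _ _

theorem Below.refl (a : S) : Below a a := (rplus_mul_self a).symm

theorem Below.trans {a b c : S} (h : Below a b) (k : Below b c) : Below a c := by
  have e : a = rplus (rplus a * b) * c := by
    rw [rplus_rplus_mul, mul_assoc, ← k]
    exact h
  rw [e]
  exact below_rplus_mul _ _

/-- The ample identity `b * c⁺ = (b * c)⁺ * b` moves the inner projection to the front. -/
theorem Below.mul {a b c d : S} (h : Below a b) (k : Below c d) : Below (a * c) (b * d) := by
  have e : a * c = rplus (rplus a * (b * c)) * (b * d) := by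
    conv_lhs => rw [h, k]
    rw [rplus_rplus_mul, mul_assoc, mul_assoc, ← mul_assoc b, rplus_ample, mul_assoc]
  rw [e]
  exact below_rplus_mul _ _

theorem below_one_rplus (a : S) : Below (rplus a) 1 := by
  rw [Below, rplus_rplus, mul_one]

theorem below_one_rstar (a : S) : Below (rstar a) 1 := by
  rw [← rplus_rstar]
  exact below_one_rplus _

end BirestrictionMonoid

open BirestrictionMonoid

namespace IsBirestrictionHom

theorem comp {S T V : Type u} [BirestrictionMonoid S] [BirestrictionMonoid T]
    [BirestrictionMonoid V] {g : T → V} {f : S → T} (hg : IsBirestrictionHom g)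
    (hf : IsBirestrictionHom f) : IsBirestrictionHom (g ∘ f) where
  map_one := by simp only [Function.comp, hf.map_one, hg.map_one]
  map_mul a b := by simp only [Function.comp, hf.map_mul, hg.map_mul]
  map_rstar a := by simp only [Function.comp, hf.map_rstar, hg.map_rstar]
  map_rplus a := by simp only [Function.comp, hf.map_rplus, hg.map_rplus]

end IsBirestrictionHom

/-! ### Inverse monoids -/

namespace InverseMonoid

variable {U : Type u} [InverseMonoid U]

theorem rstar_def (a : U) : rstar a = a⁻¹ * a := rfl

theorem rplus_def (a : U) : rplus a = a * a⁻¹ := rfl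

theorem inv_one' : (1 : U)⁻¹ = 1 := by
  have h := mul_inv_mul_self (1 : U)
  rwa [one_mul, mul_one] at h

/-- Inverting `a = a⁺ b` gives `a⁻¹ = b⁻¹ a⁺`; a projection factor on the right also yields an
element below. -/
theorem below_inv {a b : U} (h : Below a b) : Below a⁻¹ b⁻¹ := by
  have e : a⁻¹ = b⁻¹ * rplus a := by
    conv_lhs => rw [h]
    rw [mul_inv_rev', rplus_def, mul_inv_rev', inv_inv']
  rw [e]
  exact below_mul_rplus _ _

/-- Every group is an inverse monoid. -/
abbrev ofGroup (G : Type u) [Group G] : InverseMonoid G where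
  inv_inv' := inv_inv
  mul_inv_rev' := mul_inv_rev
  mul_inv_mul_self x := by simp
  mul_inv_comm x y := by simp

/-- In a product `c m * (c n)⁻¹ * c p * (c q)⁻¹` the middle pair lies below `c (p - n)` or `(c (n -
p))⁻¹`, whichever makes sense, and is absorbed by the outer factor on its side. Stated for an
abstract sequence so that it also applies to the inverses of the generators. -/
theorem exists_below_mul_inv {Y : Type u} {ι : Y → U} (hι : IsGeneratedVia ι) {c : ℕ → U}
    (h0 : c 0 = 1) (hmul : ∀ m n, Below (c m * c n) (c (m + n)))
    (hdiv : ∀ m n, Below ((c m)⁻¹ * c (m + n)) (c n))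
    (hgen : ∀ y, ∃ m n, Below (ι y) (c m * (c n)⁻¹)) (a : U) :
    ∃ m n, Below a (c m * (c n)⁻¹) := by
  refine hι {a | ∃ m n, Below a (c m * (c n)⁻¹)} hgen ⟨0, 0, ?_⟩ ?_ ?_ a
  · rw [h0, inv_one', mul_one]
    exact Below.refl 1
  · rintro a ⟨m, n, ha⟩ b ⟨p, q, hb⟩
    have hab := ha.mul hb
    rw [mul_assoc, ← mul_assoc (c n)⁻¹] at hab
    rcases le_total n p with h | h
    · obtain ⟨k, rfl⟩ := Nat.exists_eq_add_of_le h
      refine ⟨m + k, q, hab.trans ?_⟩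
      have := (Below.refl (c m)).mul ((hdiv n k).mul (Below.refl (c q)⁻¹))
      refine this.trans ?_
      rw [← mul_assoc]
      exact (hmul m k).mul (Below.refl _)
    · obtain ⟨k, rfl⟩ := Nat.exists_eq_add_of_le h
      refine ⟨m, q + k, hab.trans ((Below.refl (c m)).mul ?_)⟩
      -- Here the middle pair is the inverse of the element `(c p)⁻¹ * c (p + k)` that `hdiv`
      -- bounds.
      have h1 := below_inv (hdiv p k)
      rw [mul_inv_rev', inv_inv'] at h1
      refine (h1.mul (Below.refl (c q)⁻¹)).trans ?_
      rw [← mul_inv_rev']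
      exact below_inv (hmul q k)
  · rintro a ⟨m, n, ha⟩
    refine ⟨n, m, ?_⟩
    have := below_inv ha
    rwa [mul_inv_rev', inv_inv'] at this

theorem rplus_mul_rplus (a b : U) : rplus a * rplus b = rplus (rplus a * b) :=
  (rplus_rplus_mul a b).symm

theorem map_inv_of_group {G : Type*} [Group G] (φ : U →* G) (a : U) : φ a⁻¹ = (φ a)⁻¹ := by
  have h := congrArg φ (mul_inv_mul_self a)
  rw [map_mul, map_mul, mul_eq_right] at h
  exact eq_inv_of_mul_eq_one_right h

/-- A group image sends idempotents to `1`, so `φ s = 1`. If `s ≤ c m * (c n)⁻¹`, injectivity on the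
sequence forces `m = n`, and elements below an idempotent `(c m)⁺` are idempotent. -/
theorem isEUnitary_of_below {G : Type*} [Group G] (φ : U →* G) {c : ℕ → U}
    (hφ : Function.Injective fun n => φ (c n))
    (hc : ∀ a : U, ∃ m n, Below a (c m * (c n)⁻¹)) : IsEUnitary U := by
  intro e s he hes
  have h1 : φ e = 1 := IsIdempotentElem.iff_eq_one.1 (he.map φ)
  have h2 : φ (e * s) = 1 := IsIdempotentElem.iff_eq_one.1 (hes.map φ)
  rw [map_mul, h1, one_mul] at h2
  obtain ⟨m, n, h⟩ := hc s
  have h3 := congrArg φ h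
  rw [h2, rplus_def, map_mul, map_mul, map_mul, map_inv_of_group, map_inv_of_group, h2,
    inv_one, one_mul, one_mul] at h3
  obtain rfl : m = n := hφ (eq_of_mul_inv_eq_one h3.symm)
  change Below s (rplus (c m)) at h
  rw [h, rplus_mul_rplus]
  exact rplus_mul_rplus_self _

end InverseMonoid

/-! ### Universal properties -/

namespace FBR

variable {Y : Type u}

theorem lift_isHom {S : Type u} [BirestrictionMonoid S] (ι : Y → S) :
    IsBirestrictionHom (FBR.lift ι) where
  map_one := rfl
  map_mul := by rintro ⟨a⟩ ⟨b⟩; rfl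
  map_rstar := by rintro ⟨a⟩; rfl
  map_rplus := by rintro ⟨a⟩; rfl

theorem induction {p : FBR Y → Prop} (of : ∀ y, p (of y)) (one : p 1)
    (mul : ∀ a b, p a → p b → p (a * b)) (star : ∀ a, p a → p (rstar a))
    (plus : ∀ a, p a → p (rplus a)) (a : FBR Y) : p a := by
  obtain ⟨t⟩ := a
  induction t with
  | of y => exact of y
  | one => exact one
  | mul a b iha ihb => exact mul _ _ iha ihb
  | star a ih => exact star _ ih
  | plus a ih => exact plus _ ih

theorem hom_ext {S : Type u} [BirestrictionMonoid S] {f g : FBR Y → S}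
    (hf : IsBirestrictionHom f) (hg : IsBirestrictionHom g)
    (h : ∀ y, f (of y) = g (of y)) (a : FBR Y) : f a = g a := by
  induction a using FBR.induction with
  | of y => exact h y
  | one => rw [hf.map_one, hg.map_one]
  | mul a b iha ihb => rw [hf.map_mul, hg.map_mul, iha, ihb]
  | star a ih => rw [hf.map_rstar, hg.map_rstar, ih]
  | plus a ih => rw [hf.map_rplus, hg.map_rplus, ih]

end FBR

namespace BRestr

variable {Y : Type u} {R : FBR Y → FBR Y → Prop}

/-- The quotient map. -/
def mk (R : FBR Y → FBR Y → Prop) (a : FBR Y) : BRestr R := Quotient.mk _ a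

theorem mk_isHom : IsBirestrictionHom (mk R) where
  map_one := rfl
  map_mul _ _ := rfl
  map_rstar _ := rfl
  map_rplus _ := rfl

theorem mk_eq_of_rel {a b : FBR Y} (h : R a b) : mk R a = mk R b := Quotient.sound (.of h)

theorem isGeneratedVia_of : BirestrictionMonoid.IsGeneratedVia (BRestr.of R) := by
  rintro T hof h1 hmul hstar hplus ⟨a⟩
  change mk R a ∈ T
  induction a using FBR.induction with
  | of y => exact hof y
  | one => exact h1
  | mul a b iha ihb => exact hmul _ iha _ ihb
  | star a ih => exact hstar _ ih
  | plus a ih => exact hplus _ ih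

theorem eq_of_conGen {S : Type u} [BirestrictionMonoid S] {f : FBR Y → S}
    (hf : IsBirestrictionHom f) (hR : ∀ a b, R a b → f a = f b) {a b : FBR Y}
    (h : BRConGen R a b) : f a = f b := by
  induction h with
  | of h => exact hR _ _ h
  | refl => rfl
  | symm _ ih => exact ih.symm
  | trans _ _ ih₁ ih₂ => exact ih₁.trans ih₂
  | mul _ _ ih₁ ih₂ => rw [hf.map_mul, hf.map_mul, ih₁, ih₂]
  | rstar _ ih => rw [hf.map_rstar, hf.map_rstar, ih]
  | rplus _ ih => rw [hf.map_rplus, hf.map_rplus, ih]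

/-- The morphism from a presented birestriction monoid induced by a morphism that respects the
relations. -/
def lift {S : Type u} [BirestrictionMonoid S] (f : FBR Y → S) (hf : IsBirestrictionHom f)
    (hR : ∀ a b, R a b → f a = f b) : BRestr R → S :=
  Quotient.lift f fun _ _ h => eq_of_conGen hf hR h

theorem lift_isHom {S : Type u} [BirestrictionMonoid S] (f : FBR Y → S)
    (hf : IsBirestrictionHom f) (hR : ∀ a b, R a b → f a = f b) :
    IsBirestrictionHom (lift f hf hR) where
  map_one := hf.map_one
  map_mul := by rintro ⟨a⟩ ⟨b⟩; exact hf.map_mul a b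
  map_rstar := by rintro ⟨a⟩; exact hf.map_rstar a
  map_rplus := by rintro ⟨a⟩; exact hf.map_rplus a

end BRestr

/-- The value of a term in an inverse monoid under an assignment of its variables. -/
def InvTerm.eval {Y V : Type u} [InverseMonoid V] (ι : Y → V) : InvTerm Y → V
  | .of y => ι y
  | .one => 1
  | .mul a b => a.eval ι * b.eval ι
  | .inv a => (a.eval ι)⁻¹

theorem InvTerm.Rel.eval_eq {Y V : Type u} [InverseMonoid V] (ι : Y → V) {a b : InvTerm Y}
    (h : InvTerm.Rel a b) : a.eval ι = b.eval ι := by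
  induction h with
  | refl => rfl
  | symm _ ih => exact ih.symm
  | trans _ _ ih₁ ih₂ => exact ih₁.trans ih₂
  | mul _ _ ih₁ ih₂ => simp only [InvTerm.eval, ih₁, ih₂]
  | inv _ ih => simp only [InvTerm.eval, ih]
  | mul_assoc => exact _root_.mul_assoc _ _ _
  | one_mul => exact _root_.one_mul _
  | mul_one => exact _root_.mul_one _
  | inv_inv => exact InverseMonoid.inv_inv' _
  | mul_inv_rev => exact InverseMonoid.mul_inv_rev' _ _
  | mul_inv_mul_self => exact InverseMonoid.mul_inv_mul_self _
  | mul_inv_comm => exact InverseMonoid.mul_inv_comm _ _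

namespace FI

variable {Y : Type u}

/-- The canonical morphism from the free inverse monoid extending an assignment map. -/
def lift {V : Type u} [InverseMonoid V] (ι : Y → V) : FI Y → V :=
  Quotient.lift (InvTerm.eval ι) fun _ _ h => InvTerm.Rel.eval_eq ι h

theorem lift_mul {V : Type u} [InverseMonoid V] (ι : Y → V) (a b : FI Y) :
    lift ι (a * b) = lift ι a * lift ι b := by
  obtain ⟨a⟩ := a
  obtain ⟨b⟩ := b
  rfl

theorem lift_inv {V : Type u} [InverseMonoid V] (ι : Y → V) (a : FI Y) :
    lift ι a⁻¹ = (lift ι a)⁻¹ := by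
  obtain ⟨a⟩ := a
  rfl

theorem lift_isHom {V : Type u} [InverseMonoid V] (ι : Y → V) : IsBirestrictionHom (lift ι) where
  map_one := rfl
  map_mul := lift_mul ι
  map_rstar a := by
    rw [InverseMonoid.rstar_def, InverseMonoid.rstar_def, lift_mul, lift_inv]
  map_rplus a := by
    rw [InverseMonoid.rplus_def, InverseMonoid.rplus_def, lift_mul, lift_inv]

/-- Allows the relations imposed on the universal inverse monoid to be checked in the free
birestriction monoid. -/
theorem lift_psi {V : Type u} [InverseMonoid V] (ι : Y → V) (a : FBR Y) :
    lift ι (FBR.psi Y a) = FBR.lift ι a :=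
  FBR.hom_ext ((lift_isHom ι).comp (FBR.lift_isHom FI.of)) (FBR.lift_isHom ι) (fun _ => rfl) a

end FI

namespace UniversalInverse

variable {Y : Type u} {R : FBR Y → FBR Y → Prop}

/-- The quotient map. -/
def mk (R : FBR Y → FBR Y → Prop) (a : FI Y) : UniversalInverse R := Quotient.mk _ a

/-- The canonical assignment map. -/
def of (R : FBR Y → FBR Y → Prop) (y : Y) : UniversalInverse R := mk R (FI.of y)

theorem mk_isHom : IsBirestrictionHom (mk R) where
  map_one := rfl
  map_mul _ _ := rfl
  map_rstar _ := rfl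
  map_rplus _ := rfl

theorem isGeneratedVia_of : InverseMonoid.IsGeneratedVia (of R) := by
  rintro T hof h1 hmul hinv ⟨⟨t⟩⟩
  induction t with
  | of y => exact hof y
  | one => exact h1
  | mul a b iha ihb => exact hmul _ iha _ ihb
  | inv a ih => exact hinv _ ih

theorem lift_eq_of_conGen {V : Type u} [InverseMonoid V] {κ : Y → V}
    (hR : ∀ a b, R a b → FBR.lift κ a = FBR.lift κ b) {p q : FI Y}
    (h : InvConGen (fun p q : FI Y => ∃ a b, R a b ∧ FBR.psi Y a = p ∧ FBR.psi Y b = q) p q) :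
    FI.lift κ p = FI.lift κ q := by
  induction h with
  | of h =>
    obtain ⟨a, b, hab, rfl, rfl⟩ := h
    rw [FI.lift_psi, FI.lift_psi, hR a b hab]
  | refl => rfl
  | symm _ ih => exact ih.symm
  | trans _ _ ih₁ ih₂ => exact ih₁.trans ih₂
  | mul _ _ ih₁ ih₂ => rw [FI.lift_mul, FI.lift_mul, ih₁, ih₂]
  | inv _ ih => rw [FI.lift_inv, FI.lift_inv, ih]

/-- The morphism from the universal inverse monoid to an inverse monoid in which the relations
hold. -/
def lift {V : Type u} [InverseMonoid V] (κ : Y → V)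
    (hR : ∀ a b, R a b → FBR.lift κ a = FBR.lift κ b) : UniversalInverse R →* V where
  toFun := Quotient.lift (FI.lift κ) fun _ _ h => lift_eq_of_conGen hR h
  map_one' := rfl
  map_mul' := by rintro ⟨a⟩ ⟨b⟩; exact FI.lift_mul κ a b

theorem mk_psi_isHom : IsBirestrictionHom (mk R ∘ FBR.psi Y) :=
  mk_isHom.comp (FBR.lift_isHom _)

theorem mk_psi_eq_of_rel {a b : FBR Y} (h : R a b) :
    mk R (FBR.psi Y a) = mk R (FBR.psi Y b) :=
  Quotient.sound (.of ⟨a, b, h, rfl, rfl⟩)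

/-- The canonical morphism from a presented birestriction monoid to its universal inverse
monoid. -/
def fromBRestr (R : FBR Y → FBR Y → Prop) : BRestr R → UniversalInverse R :=
  BRestr.lift (mk R ∘ FBR.psi Y) mk_psi_isHom fun _ _ h => mk_psi_eq_of_rel h

theorem fromBRestr_isHom : IsBirestrictionHom (fromBRestr R) := BRestr.lift_isHom _ _ _

/-- A morphism to an inverse monoid factors through the universal inverse monoid. -/
theorem exists_factor {V : Type u} [InverseMonoid V] {g : BRestr R → V}
    (hg : IsBirestrictionHom g) :
    ∃ h : UniversalInverse R →* V, ∀ a, h (fromBRestr R a) = g a := by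
  have key (a : FBR Y) : FBR.lift (g ∘ BRestr.of R) a = g (BRestr.mk R a) :=
    FBR.hom_ext (FBR.lift_isHom _) (hg.comp BRestr.mk_isHom) (fun _ => rfl) a
  refine ⟨lift (g ∘ BRestr.of R) fun a b h => ?_, ?_⟩
  · rw [key, key, BRestr.mk_eq_of_rel h]
  · rintro ⟨a⟩
    exact (FI.lift_psi _ a).trans (key a)

end UniversalInverse

/-! ### The Munn representation -/

namespace PEquiv

variable {α : Type u}

/-- The symmetric inverse monoid, with maps composed from left to right. -/
instance : InverseMonoid (PEquiv α α) where
  one := PEquiv.refl α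
  mul := PEquiv.trans
  inv := PEquiv.symm
  mul_assoc := PEquiv.trans_assoc
  one_mul := PEquiv.refl_trans
  mul_one := PEquiv.trans_refl
  inv_inv' := PEquiv.symm_symm
  mul_inv_rev' := PEquiv.symm_trans_rev
  mul_inv_mul_self f := by
    change (f.trans f.symm).trans f = f
    refine PEquiv.ext fun a => Option.ext fun b => ?_
    change b ∈ (f.trans f.symm).trans f a ↔ b ∈ f a
    simp only [PEquiv.mem_trans, PEquiv.mem_iff_mem]
    constructor
    · rintro ⟨c, ⟨d, hd, hc⟩, hb⟩
      rwa [PEquiv.inj f hd hc]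
    · intro h
      exact ⟨a, ⟨b, h, h⟩, h⟩
  mul_inv_comm f g := by
    change (f.trans f.symm).trans (g.trans g.symm) = (g.trans g.symm).trans (f.trans f.symm)
    refine PEquiv.ext fun a => Option.ext fun b => ?_
    change b ∈ (f.trans f.symm).trans (g.trans g.symm) a ↔
      b ∈ (g.trans g.symm).trans (f.trans f.symm) a
    simp only [PEquiv.self_trans_symm, PEquiv.mem_trans, PEquiv.mem_ofSet_iff]
    constructor <;> rintro ⟨c, ⟨rfl, h⟩, rfl, k⟩ <;> exact ⟨_, ⟨rfl, k⟩, rfl, h⟩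

theorem mem_mul_iff {f g : PEquiv α α} {a c : α} :
    c ∈ (f * g) a ↔ ∃ b, b ∈ f a ∧ c ∈ g b := PEquiv.mem_trans f g a c

theorem mem_inv_iff {f : PEquiv α α} {a b : α} : b ∈ f⁻¹ a ↔ a ∈ f b := PEquiv.mem_iff_mem f

theorem mem_one_iff {a b : α} : b ∈ (1 : PEquiv α α) a ↔ a = b := Option.some_inj

theorem ext_mem {f g : PEquiv α α} (h : ∀ a b, b ∈ f a ↔ b ∈ g a) : f = g :=
  PEquiv.ext fun a => Option.ext fun b => h a b

end PEquiv

/-! ### The action on projections -/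

namespace BirestrictionMonoid

variable {S : Type u} [BirestrictionMonoid S]

theorem rstar_rstar_mul (a b : S) : rstar (rstar a * b) = rstar (a * b) := by
  rw [rstar_ample, rstar_mul_rstar, rstar_mul_comm, ← rstar_mul_rstar, mul_assoc, mul_rstar_self]

theorem rplus_mul_rplus (a b : S) : rplus (a * rplus b) = rplus (a * b) := by
  rw [rplus_ample, rplus_rplus_mul, rplus_mul_comm, ← rplus_rplus_mul, ← mul_assoc,
    rplus_mul_self]

/-- The projections of a birestriction monoid. -/
abbrev Proj (S : Type u) [BirestrictionMonoid S] : Type u := {a : S // rplus a = a}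

theorem Proj.rstar_eq (a : Proj S) : rstar a.1 = a.1 := by
  rw [← a.2, rstar_rplus]

theorem Proj.rplus_mul (a : Proj S) (s : S) : rplus (a.1 * s) = a.1 * rplus s := by
  conv_lhs => rw [← a.2]
  rw [rplus_rplus_mul, a.2]

theorem Proj.mul_rstar (a : Proj S) (s : S) : rstar (s * a.1) = rstar s * a.1 := by
  conv_lhs => rw [← a.rstar_eq]
  rw [rstar_mul_rstar, a.rstar_eq]

/-- Either side yields `a * s = s * b`, from which the other side is read off. This makes `a ↦ (a
s)^*` on projections below `s⁺` and `b ↦ (s b)⁺` on projections below `s^*` mutually inverse. -/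
theorem munn_symm {s : S} {a b : Proj S} :
    (b.1 * rstar s = b.1 ∧ a.1 = rplus (s * b.1)) ↔
      (a.1 * rplus s = a.1 ∧ b.1 = rstar (a.1 * s)) := by
  constructor
  · rintro ⟨h, k⟩
    have e : a.1 * s = s * b.1 := by
      rw [k, ← rplus_ample, b.2]
    refine ⟨?_, ?_⟩
    · rw [k, rplus_mul_comm, ← rplus_rplus_mul, ← mul_assoc, rplus_mul_self]
    · rw [e, b.mul_rstar, ← b.rstar_eq, rstar_mul_comm, b.rstar_eq, h]
  · rintro ⟨h, k⟩
    have e : s * b.1 = a.1 * s := by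
      rw [k, ← rstar_ample, a.rstar_eq]
    refine ⟨?_, ?_⟩
    · rw [k, ← rstar_mul_rstar, mul_assoc, mul_rstar_self]
    · rw [e, a.rplus_mul, h]

open Classical in
/-- The Munn representation of a birestriction monoid by partial bijections of its
projections. -/
noncomputable def munn (s : S) : PEquiv (Proj S) (Proj S) where
  toFun a := if a.1 * rplus s = a.1 then some ⟨rstar (a.1 * s), rplus_rstar _⟩ else none
  invFun b := if b.1 * rstar s = b.1 then some ⟨rplus (s * b.1), rplus_rplus _⟩ else none
  inv a b := by
    have h := munn_symm (s := s) (a := a) (b := b)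
    simpa [Subtype.ext_iff, eq_comm, Option.mem_def] using h

theorem mem_munn_iff {s : S} {a b : Proj S} :
    b ∈ munn s a ↔ a.1 * rplus s = a.1 ∧ b.1 = rstar (a.1 * s) := by
  classical
  change ((if a.1 * rplus s = a.1 then some ⟨rstar (a.1 * s), rplus_rstar _⟩ else none :
    Option (Proj S)) = some b) ↔ _
  simp [Subtype.ext_iff, eq_comm]

theorem exists_mem_munn_iff {s : S} {a : Proj S} :
    (∃ b, b ∈ munn s a) ↔ a.1 * rplus s = a.1 := by
  constructor
  · rintro ⟨b, hb⟩
    exact (mem_munn_iff.1 hb).1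
  · intro h
    exact ⟨⟨rstar (a.1 * s), rplus_rstar _⟩, mem_munn_iff.2 ⟨h, rfl⟩⟩

theorem exists_munn_mem_iff {s : S} {b : Proj S} :
    (∃ a, b ∈ munn s a) ↔ b.1 * rstar s = b.1 := by
  constructor
  · rintro ⟨a, ha⟩
    exact (munn_symm.2 (mem_munn_iff.1 ha)).1
  · intro h
    exact ⟨⟨rplus (s * b.1), rplus_rplus _⟩, mem_munn_iff.2 (munn_symm.1 ⟨h, rfl⟩)⟩

theorem mem_munn_rplus_iff {s : S} {a b : Proj S} :
    b ∈ munn (rplus s) a ↔ a.1 * rplus s = a.1 ∧ a = b := by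
  rw [mem_munn_iff, rplus_rplus]
  refine and_congr_right fun h => ?_
  rw [h, a.rstar_eq, eq_comm]
  exact Subtype.ext_iff.symm

theorem munn_isHom : IsBirestrictionHom (munn (S := S)) where
  map_one := PEquiv.ext_mem fun a b => by
    rw [← rplus_one, mem_munn_rplus_iff, rplus_one, mul_one, PEquiv.mem_one_iff]
    simp
  map_mul s t := PEquiv.ext_mem fun a c => by
    simp only [PEquiv.mem_mul_iff, mem_munn_iff]
    constructor
    · rintro ⟨h, k⟩
      refine ⟨⟨rstar (a.1 * s), rplus_rstar _⟩, ⟨?_, rfl⟩, ?_, ?_⟩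
      · rw [← h, mul_assoc, rplus_mul_comm, ← rplus_rplus_mul, ← mul_assoc (rplus s),
          rplus_mul_self]
      · change rstar (a.1 * s) * rplus t = rstar (a.1 * s)
        rw [← rstar_rplus, ← rstar_mul_rstar, rstar_rplus, mul_assoc, rplus_ample, ← mul_assoc, h]
      · rw [k, rstar_rstar_mul, mul_assoc]
    · rintro ⟨b, ⟨h, hb⟩, k, hc⟩
      rw [hb] at k hc
      have e : a.1 * s * rplus t = a.1 * s := by
        rw [← mul_rstar_self (a.1 * s), mul_assoc, k]
      refine ⟨?_, ?_⟩
      · rw [← a.rplus_mul, ← mul_assoc, ← rplus_mul_rplus, e, a.rplus_mul, h]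
      · rw [hc, rstar_rstar_mul, mul_assoc]
  map_rstar s := PEquiv.ext_mem fun a b => by
    rw [← rplus_rstar, mem_munn_rplus_iff, rplus_rstar, InverseMonoid.rstar_def,
      PEquiv.mem_mul_iff, ← exists_munn_mem_iff]
    simp only [PEquiv.mem_inv_iff]
    constructor
    · rintro ⟨⟨c, hc⟩, rfl⟩
      exact ⟨c, hc, hc⟩
    · rintro ⟨c, hc, hc'⟩
      exact ⟨⟨c, hc⟩, Option.some_inj.1 (hc.symm.trans hc')⟩
  map_rplus s := PEquiv.ext_mem fun a b => by
    rw [mem_munn_rplus_iff, InverseMonoid.rplus_def, PEquiv.mem_mul_iff, ← exists_mem_munn_iff]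
    simp only [PEquiv.mem_inv_iff]
    constructor
    · rintro ⟨⟨c, hc⟩, rfl⟩
      exact ⟨c, hc, hc⟩
    · rintro ⟨c, hc, hc'⟩
      exact ⟨⟨c, hc⟩, PEquiv.inj _ hc hc'⟩

/-- A projection acts as the identity on the projections below it. Its domain contains the
projection itself, so equal domains force each of the two to lie below the other. -/
theorem rplus_eq_of_munn_eq {s t : S} (h : munn (rplus s) = munn (rplus t)) :
    rplus s = rplus t := by
  have key {s t : S} (h : munn (rplus s) = munn (rplus t)) : rplus s * rplus t = rplus s := by
    have : (⟨rplus s, rplus_rplus s⟩ : Proj S) ∈ munn (rplus s) ⟨rplus s, rplus_rplus s⟩ :=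
      mem_munn_rplus_iff.2 ⟨rplus_mul_rplus_self s, rfl⟩
    rw [h] at this
    exact (mem_munn_rplus_iff.1 this).1
  rw [← key h, rplus_mul_comm, key h.symm]

end BirestrictionMonoid

/-- The projections of a presented birestriction monoid embed into its universal inverse
monoid. -/
theorem UniversalInverse.rplus_eq_of_fromBRestr_eq {Y : Type u} {R : FBR Y → FBR Y → Prop}
    {s t : BRestr R} (h : fromBRestr R (rplus s) = fromBRestr R (rplus t)) :
    rplus s = rplus t := by
  -- The Munn representation takes values in an inverse monoid, so it cannot separate elements that
  -- the universal inverse monoid identifies.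
  obtain ⟨g, hg⟩ := exists_factor (R := R) munn_isHom
  apply rplus_eq_of_munn_eq
  rw [← hg, ← hg, h]

/-! ### One generator -/

/-- The word of length `n + 1` over a one-letter alphabet. -/
def powWord (X : Type u) [Unique X] (n : ℕ) : FreeSemigroup X := ⟨default, List.replicate n default⟩

section powWord

variable {X : Type u} [Unique X]

/-- The index is one less than the length, hence the extra `1`. -/
theorem powWord_mul (m n : ℕ) : powWord X m * powWord X n = powWord X (m + n + 1) := by
  apply FreeSemigroup.ext
  · rfl
  · change List.replicate m default ++ default :: List.replicate n default = List.replicate _ _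
    rw [← List.replicate_succ, List.replicate_append_replicate, add_assoc]

theorem exists_eq_powWord (w : FreeSemigroup X) : ∃ n, w = powWord X n :=
  ⟨w.tail.length, FreeSemigroup.ext (Unique.eq_default _)
    (List.eq_replicate_iff.2 ⟨rfl, fun _ _ => Unique.eq_default _⟩)⟩

theorem powWord_zero (x : X) : powWord X 0 = FreeSemigroup.of x :=
  FreeSemigroup.ext (Unique.default_eq x) rfl

end powWord

/-- The values of the generators `ū`, indexed by the length of `u`, with value `1` at `0`. -/
def barPow {X M : Type u} [Unique X] [Monoid M] (ι : ExtGen X → M) : ℕ → M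
  | 0 => 1
  | n + 1 => ι (Sum.inr (powWord X n))

/-- The assignment `ι` respects the relations with index `i`. -/
def Respects {X S : Type u} [BirestrictionMonoid S] (i : StrengthIndex) (ι : ExtGen X → S) :
    Prop :=
  ∀ a b, NRel X i a b → FBR.lift ι a = FBR.lift ι b

/-! ### Order consequences of the relations -/

namespace Respects

variable {X : Type u} {i : StrengthIndex}

section Birestriction

variable {S : Type u} [BirestrictionMonoid S] {ι : ExtGen X → S}

theorem le (h : Respects i ι) (x : X) :
    ι (Sum.inl x) = ι (Sum.inr (FreeSemigroup.of x)) * rstar (ι (Sum.inl x)) :=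
  h (genX x) (genBar (FreeSemigroup.of x) * rstar (genX x)) <| by
    cases i
    · exact .le x
    · exact .le x
    · exact .inl (.le x)

theorem left (h : Respects i ι) (hi : i ≠ .rs) (v w : FreeSemigroup X) :
    ι (Sum.inr v) * ι (Sum.inr w) = rplus (ι (Sum.inr v)) * ι (Sum.inr (v * w)) :=
  h (genBar v * genBar w) (rplus (genBar v) * genBar (v * w)) <| by
    cases i
    · exact .strong v w
    · exact absurd rfl hi
    · exact .inl (.strong v w)

theorem right (h : Respects .rs ι) (v w : FreeSemigroup X) :
    ι (Sum.inr v) * ι (Sum.inr w) = ι (Sum.inr (v * w)) * rstar (ι (Sum.inr w)) :=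
  h (genBar v * genBar w) (genBar (v * w) * rstar (genBar w)) (.strong v w)

theorem below_mul (h : Respects i ι) (v w : FreeSemigroup X) :
    Below (ι (Sum.inr v) * ι (Sum.inr w)) (ι (Sum.inr (v * w))) := by
  by_cases hi : i = .rs
  · subst hi
    rw [h.right]
    exact below_mul_rstar _ _
  · rw [h.left hi]
    exact below_rplus_mul _ _

variable [Unique X]

theorem below_barPow_mul (h : Respects i ι) (m n : ℕ) :
    Below (barPow ι m * barPow ι n) (barPow ι (m + n)) := by
  rcases m with _ | m
  · rw [zero_add, barPow, one_mul]
    exact Below.refl _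
  rcases n with _ | n
  · rw [add_zero, barPow, barPow, mul_one]
    exact Below.refl _
  have := h.below_mul (powWord X m) (powWord X n)
  rw [powWord_mul] at this
  rwa [show m + 1 + (n + 1) = m + n + 1 + 1 by omega]

theorem exists_below_barPow_gen (h : Respects i ι) (y : ExtGen X) :
    ∃ n, Below (ι y) (barPow ι n) := by
  rcases y with x | w
  · refine ⟨1, ?_⟩
    rw [h.le x, barPow, powWord_zero x]
    exact below_mul_rstar _ _
  · obtain ⟨n, rfl⟩ := exists_eq_powWord w
    exact ⟨n + 1, Below.refl _⟩

/-- Images of the unary operations are projections and lie below `1`, the term of index `0`;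
products add indices. -/
theorem exists_below_barPow (h : Respects i ι) (hι : BirestrictionMonoid.IsGeneratedVia ι)
    (a : S) : ∃ n, Below a (barPow ι n) := by
  refine hι {a | ∃ n, Below a (barPow ι n)} h.exists_below_barPow_gen ⟨0, Below.refl 1⟩ ?_ ?_ ?_ a
  · rintro a ⟨m, ha⟩ b ⟨n, hb⟩
    exact ⟨m + n, (ha.mul hb).trans (h.below_barPow_mul m n)⟩
  · rintro a -
    exact ⟨0, below_one_rstar a⟩
  · rintro a -
    exact ⟨0, below_one_rplus a⟩

end Birestriction

section Inverse

variable [Unique X] {U : Type u} [InverseMonoid U] {ι : ExtGen X → U}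

open InverseMonoid

/-- Insert `(c m)⁻¹ = (c m)⁻¹ * c m * (c m)⁻¹`. Left strength turns `(c m)⁺ * c (m + n)` into `c m *
c n`, leaving `(c m)^* * c n`. -/
theorem below_inv_barPow_mul (h : Respects i ι) (hi : i ≠ .rs) (m n : ℕ) :
    Below ((barPow ι m)⁻¹ * barPow ι (m + n)) (barPow ι n) := by
  rcases m with _ | m
  · rw [zero_add, barPow, inv_one', one_mul]
    exact Below.refl _
  rcases n with _ | n
  · exact below_one_rstar (barPow ι (m + 1))
  have k := h.left hi (powWord X m) (powWord X n)
  rw [powWord_mul] at k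
  change barPow ι (m + 1) * barPow ι (n + 1) =
    rplus (barPow ι (m + 1)) * barPow ι (m + n + 1 + 1) at k
  rw [show m + 1 + (n + 1) = m + n + 1 + 1 by omega, ← inv_mul_inv_self, mul_assoc, mul_assoc,
    ← mul_assoc (barPow ι (m + 1)), ← rplus_def, ← k, ← mul_assoc, ← rstar_def, ← rplus_rstar]
  exact below_rplus_mul _ _

theorem below_barPow_mul_inv (h : Respects .rs ι) (m n : ℕ) :
    Below (barPow ι (n + m) * (barPow ι m)⁻¹) (barPow ι n) := by
  rcases m with _ | m
  · rw [add_zero, barPow.eq_1, inv_one', mul_one]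
    exact Below.refl _
  rcases n with _ | n
  · rw [zero_add]
    exact below_one_rplus (barPow ι (m + 1))
  have k := h.right (powWord X n) (powWord X m)
  rw [powWord_mul] at k
  change barPow ι (n + 1) * barPow ι (m + 1) =
    barPow ι (n + m + 1 + 1) * rstar (barPow ι (m + 1)) at k
  rw [show n + 1 + (m + 1) = n + m + 1 + 1 by omega, ← inv_mul_inv_self, ← rstar_def,
    ← mul_assoc, ← k, mul_assoc, ← rplus_def]
  exact below_mul_rplus _ _

theorem isEUnitary (h : Respects i ι) (hι : InverseMonoid.IsGeneratedVia ι) {G : Type*} [Group G]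
    (φ : U →* G) (hφ : Function.Injective fun n => φ (barPow ι n)) : IsEUnitary U := by
  by_cases hi : i = .rs
  · subst hi
    -- Right strength controls `c (n + m) * (c m)⁻¹` rather than `(c m)⁻¹ * c (m + n)`; passing to
    -- inverses restores the form required by `exists_below_mul_inv`.
    refine isEUnitary_of_below φ (c := fun n => (barPow ι n)⁻¹) ?_
      (exists_below_mul_inv hι inv_one' ?_ ?_ ?_)
    · intro m n hmn
      simp only [map_inv_of_group, inv_inj] at hmn
      exact hφ hmn
    · intro m n
      rw [← mul_inv_rev', add_comm]
      exact below_inv (h.below_barPow_mul n m)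
    · intro m n
      have := below_inv (h.below_barPow_mul_inv m n)
      rwa [mul_inv_rev', add_comm] at this
    · intro y
      obtain ⟨n, hn⟩ := h.exists_below_barPow_gen y
      refine ⟨0, n, ?_⟩
      rwa [inv_inv', barPow.eq_1, inv_one', one_mul]
  · refine isEUnitary_of_below φ hφ
      (exists_below_mul_inv hι rfl h.below_barPow_mul (h.below_inv_barPow_mul hi) ?_)
    intro y
    obtain ⟨n, hn⟩ := h.exists_below_barPow_gen y
    refine ⟨n, 0, ?_⟩
    rwa [barPow.eq_1, inv_one', mul_one]

end Inverse

end Respects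

/-! ### The degree -/

/-- The infinite cyclic group. -/
abbrev DegreeGroup : Type u := ULift.{u} (Multiplicative ℤ)

/-- In a group both unary operations are constantly `1`, so all the relations reduce to additivity
of word length. -/
instance : InverseMonoid DegreeGroup.{u} := InverseMonoid.ofGroup _

/-- The degrees of the generators. -/
def genDegree (X : Type u) : ExtGen X → DegreeGroup.{u}
  | .inl _ => ⟨.ofAdd 1⟩
  | .inr w => ⟨.ofAdd (w.length : ℤ)⟩

theorem DegreeGroup.rplus_eq (a : DegreeGroup.{u}) : rplus a = 1 := mul_inv_cancel a

theorem DegreeGroup.rstar_eq (a : DegreeGroup.{u}) : rstar a = 1 := inv_mul_cancel a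

theorem genDegree_inr_mul {X : Type u} (v w : FreeSemigroup X) :
    genDegree X (.inr v) * genDegree X (.inr w) = genDegree X (.inr (v * w)) := by
  apply ULift.ext
  change Multiplicative.ofAdd ((v.length : ℤ) + w.length) = Multiplicative.ofAdd ((v * w).length : ℤ)
  rw [FreeSemigroup.length_mul]
  push_cast
  rfl

theorem genDegree_respects_left (X : Type u) {a b : FBR (ExtGen X)} (h : NLeft X a b) :
    FBR.lift (genDegree X) a = FBR.lift (genDegree X) b := by
  cases h with
  | le x =>
    rw [(FBR.lift_isHom _).map_mul, (FBR.lift_isHom _).map_rstar, DegreeGroup.rstar_eq, mul_one]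
    rfl
  | strong v w =>
    rw [(FBR.lift_isHom _).map_mul, (FBR.lift_isHom _).map_mul, (FBR.lift_isHom _).map_rplus,
      DegreeGroup.rplus_eq, one_mul]
    exact genDegree_inr_mul v w

theorem genDegree_respects_right (X : Type u) {a b : FBR (ExtGen X)} (h : NRight X a b) :
    FBR.lift (genDegree X) a = FBR.lift (genDegree X) b := by
  cases h with
  | le x =>
    rw [(FBR.lift_isHom _).map_mul, (FBR.lift_isHom _).map_rstar, DegreeGroup.rstar_eq, mul_one]
    rfl
  | strong v w =>
    rw [(FBR.lift_isHom _).map_mul, (FBR.lift_isHom _).map_mul, (FBR.lift_isHom _).map_rstar,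
      DegreeGroup.rstar_eq, mul_one]
    exact genDegree_inr_mul v w

theorem genDegree_respects (X : Type u) (i : StrengthIndex) : Respects i (genDegree X) := by
  intro a b h
  cases i with
  | ls => exact genDegree_respects_left X h
  | rs => exact genDegree_respects_right X h
  | s => exact h.elim (genDegree_respects_left X) (genDegree_respects_right X)

/-- The degree morphism from `I_i` to the infinite cyclic group. -/
def degree (X : Type u) (i : StrengthIndex) : IMon X i →* DegreeGroup.{u} :=
  UniversalInverse.lift (genDegree X) (genDegree_respects X i)

theorem degree_barPow (X : Type u) [Unique X] (i : StrengthIndex) (n : ℕ) :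
    degree X i (barPow (UniversalInverse.of (NRel X i)) n) = ⟨.ofAdd (n : ℤ)⟩ := by
  rcases n with _ | n
  · exact map_one _
  · change genDegree X (.inr (powWord X n)) = _
    simp [genDegree, powWord, FreeSemigroup.length]

theorem degree_barPow_injective (X : Type u) [Unique X] (i : StrengthIndex) :
    Function.Injective fun n => degree X i (barPow (UniversalInverse.of (NRel X i)) n) := by
  intro m n h
  simpa [degree_barPow] using h

/-! ### Embedding `F_i` into `I_i` -/

theorem fMon_respects (X : Type u) (i : StrengthIndex) : Respects i (FMon.of X i) := by
  intro a b h
  have key (a : FBR (ExtGen X)) : FBR.lift (FMon.of X i) a = BRestr.mk (NRel X i) a :=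
    FBR.hom_ext (FBR.lift_isHom _) BRestr.mk_isHom (fun _ => rfl) a
  rw [key, key, BRestr.mk_eq_of_rel h]

theorem iMon_respects (X : Type u) (i : StrengthIndex) :
    Respects i (UniversalInverse.of (NRel X i)) := by
  intro a b h
  have key (a : FBR (ExtGen X)) : FBR.lift (UniversalInverse.of (NRel X i)) a =
      UniversalInverse.mk (NRel X i) (FBR.psi _ a) :=
    FBR.hom_ext (FBR.lift_isHom _) UniversalInverse.mk_psi_isHom (fun _ => rfl) a
  rw [key, key, UniversalInverse.mk_psi_eq_of_rel h]

theorem fromBRestr_barPow (X : Type u) [Unique X] (i : StrengthIndex) (n : ℕ) :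
    UniversalInverse.fromBRestr (NRel X i) (barPow (FMon.of X i) n) =
      barPow (UniversalInverse.of (NRel X i)) n := by
  cases n <;> rfl

/-- Writing `s = s⁺ * c m` and `t = t⁺ * c n`, equality of images gives `m = n` by degree and `s⁺ =
t⁺` by faithfulness on projections. -/
theorem fromBRestr_injective (X : Type u) [Unique X] (i : StrengthIndex) :
    Function.Injective (UniversalInverse.fromBRestr (NRel X i)) := by
  have hf := UniversalInverse.fromBRestr_isHom (R := NRel X i)
  -- The degree kills the factor `a⁺`, so an element has the degree of any `c n` above it.
  have hdeg {a : FMon X i} {n : ℕ} (h : Below a (barPow (FMon.of X i) n)) :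
      degree X i (UniversalInverse.fromBRestr (NRel X i) a) =
        degree X i (barPow (UniversalInverse.of (NRel X i)) n) := by
    conv_lhs => rw [h]
    rw [hf.map_mul, hf.map_rplus, fromBRestr_barPow, map_mul, InverseMonoid.rplus_def, map_mul,
      InverseMonoid.map_inv_of_group, mul_inv_cancel, one_mul]
  intro s t hst
  obtain ⟨m, hm⟩ := (fMon_respects X i).exists_below_barPow BRestr.isGeneratedVia_of s
  obtain ⟨n, hn⟩ := (fMon_respects X i).exists_below_barPow BRestr.isGeneratedVia_of t
  obtain rfl : m = n := degree_barPow_injective X i <| by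
    change degree X i _ = degree X i _
    rw [← hdeg hm, ← hdeg hn, hst]
  have hp : rplus s = rplus t := UniversalInverse.rplus_eq_of_fromBRestr_eq <| by
    rw [hf.map_rplus, hf.map_rplus, hst]
  rw [hm, hn, hp]

theorem mainTheorem8 {X : Type*} [Unique X] (i : StrengthIndex) :
    AdmitsGeometricModel (FMon.of X i) ∧ InverseMonoid.IsEUnitary (IMon X i) := by
  have hE : InverseMonoid.IsEUnitary (IMon X i) :=
    (iMon_respects X i).isEUnitary UniversalInverse.isGeneratedVia_of (degree X i)
      (degree_barPow_injective X i)
  exact ⟨⟨BRestr.isGeneratedVia_of, IMon X i, inferInstance, UniversalInverse.of (NRel X i),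
    UniversalInverse.fromBRestr (NRel X i), UniversalInverse.isGeneratedVia_of, hE,
    UniversalInverse.fromBRestr_isHom, fromBRestr_injective X i, fun _ => rfl⟩, hE⟩
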